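/- For each $i$ in an index set $I$ let $q_i$ and $t_i$ be powers of $2$, let $n_i=t_i^2-1\ge 1$ and let $m_i$ be a positive multiple of $n_i$. Let $\sigma_i$ be a generator of $\mathrm{Gal}(\mathbb F_{q_i^{m_i}}/\mathbb F_{q_i})$, and let $\mathcal C_i$ be a rank-metric code of $\sigma_i$-linearized polynomials over $\mathbb F_{q_i^{m_i}}$, that is, a set of $\mathbb F_{q_i}$-linear endomorphisms of $\mathbb F_{q_i^{m_i}}$. Let $\mathrm C_i=\{(g(\alpha_1),\dots,g(\alpha_{n_i})) : g\in\mathcal C_i\}\subseteq \mathbb F_{q_i^{m_i}}^{n_i}$ be its evaluation code over an $\mathbb F_{q_i}$-basis $\alpha_1,\dots,\alpha_{n_i}$ of $\beta_i\mathbb F_{q_i^{n_i}}$, where $\beta_i\in\mathbb F_{q_i^{m_i}}^*$, and let $d_i$ be the minimum distance of $\mathrm C_i$ with respect to the rank distance $d(\mathbf u,\mathbf v)=\mathrm{rk}(\mathbf u-\mathbf v)$, where $\mathrm{rk}(\mathbf v)=\dim_{\mathbb F_{q_i}}\langle v_1,\dots,v_{n_i}\rangle_{\mathbb F_{q_i}}$.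 Suppose that for every $i$: 1. $n_i-d_i+1\le t_i\le n_i-\lfloor (d_i-1)/2\rfloor-1$; 2. $\mathcal C_i$ contains $(\mathcal G_{n_i,2,\sigma_i})^{\sigma_i^{j_i}}=\{(a_0x+a_1x^{\sigma_i})^{\sigma_i^{j_i}} : a_0,a_1\in\mathbb F_{q_i^{n_i}}\}$ for some integer $j_i$ with $0\le j_i<n_i-t_i$. Suppose that the lengths $n_i$ are unbounded. Then the family $(\mathrm C_i)_{i\in I}$ is not efficiently list decodable at any radii $\tau_i\ge n_i-t_i$. That is, there is no polynomial-time list decoding algorithm: no Turing machine, even if it is given an arbitrary string of advice on the code $\mathrm C_i$ and an arbitrary injective representation of the elements of $\mathbb F_{q_i^{m_i}}$ by bit strings, outputs, for every $i$ and every received word $\mathbf w\in\mathbb F_{q_i^{m_i}}^{n_i}$, a list, written out codeword by codeword, of all $\mathbf c\in \mathrm C_i$ with $\mathrm{rk}(\mathbf w-\mathbf c)\le\tau_i$ within a number of steps bounded by a polynomial in the length $n_i$. -/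

import Mathlib

/-! ### Rank-metric codes -/

namespace RankMetric

/-- The rank weight of `v ∈ Kⁿ` over `F`: the `F`-dimension of the span of its entries. -/
noncomputable def rankWeight (F : Type*) {K : Type*} [Field F] [Field K] [Algebra F K] {n : ℕ}
    (v : Fin n → K) : ℕ :=
  Module.finrank F (Submodule.span F (Set.range v))

/-- The rank distance. -/
noncomputable def rankDist (F : Type*) {K : Type*} [Field F] [Field K] [Algebra F K] {n : ℕ}
    (u v : Fin n → K) : ℕ :=
  rankWeight F (u - v)

/-- The ball `B_τ(w)` in the rank metric. -/
def ball (F : Type*) {K : Type*} [Field F] [Field K] [Algebra F K] {n : ℕ}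
    (τ : ℕ) (w : Fin n → K) : Set (Fin n → K) :=
  {c | rankDist F w c ≤ τ}

/-- `d` is the minimum distance of the code `C`: the least distance of two distinct codewords. -/
def IsMinDist (F : Type*) {K : Type*} [Field F] [Field K] [Algebra F K] {n : ℕ}
    (C : Set (Fin n → K)) (d : ℕ) : Prop :=
  IsLeast {r | ∃ u ∈ C, ∃ v ∈ C, u ≠ v ∧ r = rankDist F u v} d

/-- The `σ`-polynomial `∑_{i<k} a_i x^{σ^i}`, as an `F`-linear endomorphism of `K`. -/
def sigmaPoly {F K : Type*} [Field F] [Field K] [Algebra F K] (σ : K ≃ₐ[F] K) {k : ℕ}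
    (a : Fin k → K) : K →ₗ[F] K :=
  ∑ i : Fin k, a i • (σ ^ (i : ℕ)).toLinearMap

/-- The generalized Gabidulin code
`{a₀ x + a₁ x^σ + ⋯ + a_{k-1} x^{σ^{k-1}} : a_i ∈ E}` with coefficients in the subfield `E` of `K`,
seen among the endomorphisms of `K`. For `E = 𝔽_{q^n}` this is `𝒢_{n,k,σ}`. -/
def gabidulin {F K : Type*} [Field F] [Field K] [Algebra F K] (σ : K ≃ₐ[F] K)
    (E : IntermediateField F K) (k : ℕ) : Set (K →ₗ[F] K) :=
  {f | ∃ a : Fin k → K, (∀ i, a i ∈ E) ∧ f = sigmaPoly σ a}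

/-- `𝒢^{σ^j} = {f(x)^{σ^j} : f ∈ 𝒢}`. -/
def sigmaPower {F K : Type*} [Field F] [Field K] [Algebra F K] (σ : K ≃ₐ[F] K) (j : ℕ)
    (G : Set (K →ₗ[F] K)) : Set (K →ₗ[F] K) :=
  (fun f => (σ ^ j).toLinearMap ∘ₗ f) '' G

/-- The evaluation code `{(g(α₁), …, g(αₙ)) : g ∈ 𝒞}`. -/
def evalCode {F K : Type*} [Field F] [Field K] [Algebra F K] {n : ℕ}
    (𝒞 : Set (K →ₗ[F] K)) (α : Fin n → K) : Set (Fin n → K) :=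
  (fun g l => g (α l)) '' 𝒞

/-- `α₁, …, αₙ` is an `F`-basis of the `F`-subspace `β E` of `K`. -/
def IsBasisOfMul {F K : Type*} [Field F] [Field K] [Algebra F K] {n : ℕ}
    (β : K) (E : IntermediateField F K) (α : Fin n → K) : Prop :=
  LinearIndependent F α ∧ (Submodule.span F (Set.range α) : Set K) = {y | ∃ x ∈ E, y = β * x}

/-! ### Turing machines with running time -/

/-- The symbols machines read and write: bits and two separators. -/
inductive Symb where
  | bit (b : Bool)
  | comma
  | semicolon

/-- A deterministic Turing machine with finitely many states and `extra + 1` two-way infinite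
tapes over the alphabet `Symb` with a blank (`none`), and a write-only output tape. Given the state
and the scanned symbols, it halts (`none`), or it goes to a new state, on each tape writes a symbol
and then moves the head one cell or lets it stay, and appends at most one symbol to the output. -/
structure Machine where
  State : Type
  finite_state : Finite State
  extra : ℕ
  start : State
  trans : State → (Fin (extra + 1) → Option Symb) →
    Option (State × (Fin (extra + 1) → Option Symb × Option Turing.Dir) × Option Symb)

namespace Machine

/-- Configurations: the state, the contents of the tapes with the head positions, and what has
been written to the output tape. -/
structure Config (M : Machine) where
  state : M.State
  tapes : Fin (M.extra + 1) → Turing.Tape (Option Symb)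
  output : List Symb

/-- Move the head of a tape, or let it stay. -/
def moveHead (T : Turing.Tape (Option Symb)) : Option Turing.Dir → Turing.Tape (Option Symb)
  | none => T
  | some D => T.move D

/-- One step; `none` if the machine has halted. -/
def step (M : Machine) (c : M.Config) : Option M.Config :=
  (M.trans c.state (fun k => (c.tapes k).head)).map fun r =>
    { state := r.1
      tapes := fun k => moveHead ((c.tapes k).write (r.2.1 k).1) (r.2.1 k).2
      output := c.output ++ r.2.2.toList }

/-- The initial configuration: the input on tape `0`, its first symbol being scanned, the other
tapes blank, nothing written to the output tape. -/
def init (M : Machine) (input : List Symb) : M.Config where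
  state := M.start
  tapes := fun k => Turing.Tape.mk₁ (if k = 0 then input.map some else [])
  output := []

/-- The configuration after `T` steps (a halted machine stays where it is). -/
def run (M : Machine) (input : List Symb) (T : ℕ) : M.Config :=
  (fun c => (M.step c).getD c)^[T] (M.init input)

/-- On the given input, `M` halts after at most `T` steps, and then its output is `out`. -/
def OutputsWithin (M : Machine) (input out : List Symb) (T : ℕ) : Prop :=
  M.step (M.run input T) = none ∧ (M.run input T).output = out

end Machine

/-! ### Efficient list decoding -/

/-- A word of `Kⁿ`, written entry by entry, given a representation `enc` of the elements of `K`
by bit strings. -/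
def encodeWord {K : Type*} (enc : K → List Bool) {n : ℕ} (w : Fin n → K) : List Symb :=
  (List.ofFn w).flatMap fun x => (enc x).map Symb.bit ++ [Symb.comma]

/-- A list of words, written word by word. -/
def encodeList {K : Type*} (enc : K → List Bool) {n : ℕ} (L : List (Fin n → K)) : List Symb :=
  L.flatMap fun c => encodeWord enc c ++ [Symb.semicolon]

/-- What the decoder receives: a description of the code, and the received word. -/
def encodeInput {K : Type*} (desc : List Bool) (enc : K → List Bool) {n : ℕ} (w : Fin n → K) :
    List Symb :=
  desc.map Symb.bit ++ [Symb.semicolon] ++ encodeWord enc w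

/-- A family of codes `C i ⊆ (K i)^(n i)` is efficiently list decodable at the radii `τ i` if it
has a polynomial-time list decoding algorithm: a Turing machine which, for every code of the family
and every received word `w`, lists all codewords in the ball `B_τ(w)`, in a number of steps which
is bounded by a polynomial in the length of the code. How field elements are represented by bit
strings may be chosen to suit the algorithm, and so may the string that tells the machine which of
the codes is used; that string may carry any information on the code. -/
def EfficientlyListDecodable {ι : Type*} (F : ι → Type*) {K : ι → Type*}
    [∀ i, Field (F i)] [∀ i, Field (K i)] [∀ i, Algebra (F i) (K i)]
    {n : ι → ℕ} (C : ∀ i, Set (Fin (n i) → K i)) (τ : ι → ℕ) : Prop :=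
  ∃ (M : Machine) (desc : ι → List Bool) (enc : ∀ i, K i → List Bool) (p : Polynomial ℕ),
    (∀ i, Function.Injective (enc i)) ∧
    ∀ (i : ι) (w : Fin (n i) → K i), ∃ L : List (Fin (n i) → K i),
      (∀ c, c ∈ L ↔ c ∈ C i ∩ ball (F i) (τ i) w) ∧
      M.OutputsWithin (encodeInput (desc i) (enc i) w) (encodeList (enc i) L) (p.eval (n i))

end RankMetric

/-!
Let `q = |F|` and `n = s r = [E : F]`, let `L` be the subfield of degree `r` of `E`, and let `w` be
the map that raises the coordinates with respect to an `L`-basis `b` of `E` to the power `q`. For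
every nonzero `x` in `L`, the map `w` agrees with the multiplication by `x ^ (q - 1)` on the
`s`-dimensional `F`-span of the `x bₖ`, so `w` has rank distance at most `n - s` from that
multiplication. The powers `x ^ (q - 1)` take `(q ^ r - 1) / (q - 1) ≥ q ^ (r - 1)` values.
Multiplying by `β` and applying `σ ^ j` turns all these multiplications into codewords in one ball
of radius `n - s`.

For `n = t² - 1` take `s = t + 1` and `r = t - 1`: the ball of radius `n - t - 1` then contains
`q ^ (t - 2)` codewords, which is more than any polynomial in `n`, whereas a machine writes at most
one symbol per step.
-/

namespace RankMetric

open Module (finrank)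

section Multipliers

variable {F L V κ : Type*} [Field F] [Field L] [Algebra F L]

/-- The map `∑ₖ xₖ bₖ ↦ ∑ₖ φ(xₖ) bₖ` that applies an `F`-linear `φ : L → L` to the coordinates with
respect to an `L`-basis `b`. With `φ` the Frobenius of `F`, it is the received word with a long
list. -/
noncomputable def coordwise [AddCommGroup V] [Module F V] [Module L V] [IsScalarTower F L V]
    [Finite κ] (b : Module.Basis κ L V) (φ : L →ₗ[F] L) : V →ₗ[F] V :=
  (b.equivFun.restrictScalars F).symm.conj (φ.compLeft κ)

theorem coordwise_smul_basis [AddCommGroup V] [Module F V] [Module L V] [IsScalarTower F L V]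
    [Finite κ] (b : Module.Basis κ L V) (φ : L →ₗ[F] L) (x : L) (k : κ) :
    coordwise b φ (x • b k) = φ x • b k := by
  classical
  apply b.equivFun.injective
  ext l
  simp [coordwise, LinearEquiv.conj_apply, Finsupp.single_apply, apply_ite φ]

theorem finrank_le_finrank_ker_coordwise_sub_lsmul [AddCommGroup V] [Module F V] [Module L V]
    [IsScalarTower F L V] [FiniteDimensional F V] [Finite κ] (b : Module.Basis κ L V)
    (φ : L →ₗ[F] L) {x : L} (hx : x ≠ 0) :
    finrank L V ≤ finrank F (LinearMap.ker (coordwise b φ - Algebra.lsmul F F V (φ x / x))) := by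
  have := Fintype.ofFinite κ
  have hmem (k : κ) : x • b k ∈ LinearMap.ker (coordwise b φ - Algebra.lsmul F F V (φ x / x)) := by
    rw [LinearMap.mem_ker, LinearMap.sub_apply, coordwise_smul_basis]
    change φ x • b k - (φ x / x) • x • b k = 0
    rw [smul_smul, div_mul_cancel₀ _ hx, sub_self]
  have hindep : LinearIndependent F fun k => x • b k :=
    (b.linearIndependent.units_smul fun _ => Units.mk0 x hx).restrict_scalars' F
  have hker : LinearIndependent F fun k => (⟨x • b k, hmem k⟩ : LinearMap.ker _) :=
    .of_comp (Submodule.subtype _) hindep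
  rw [Module.finrank_eq_card_basis b]
  exact hker.fintype_card_le_finrank

theorem pow_finrank_sub_one_le_card_range_powMonoidHom [Finite L] :
    Nat.card F ^ (finrank F L - 1) ≤
      Nat.card (powMonoidHom (Nat.card F - 1) : Lˣ →* Lˣ).range := by
  have : Finite F := Finite.of_injective _ (algebraMap F L).injective
  have hrange : Nat.card (powMonoidHom (Nat.card F - 1) : Lˣ →* Lˣ).range =
      ∑ k ∈ Finset.range (finrank F L), Nat.card F ^ k := by
    rw [IsCyclic.card_powMonoidHom_range, Nat.card_units, Module.natCard_eq_pow_finrank (K := F),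
      Nat.gcd_eq_right (Nat.sub_one_dvd_pow_sub_one _ _), Nat.geomSum_eq Finite.one_lt_card]
  rw [hrange]
  exact Finset.single_le_sum (f := fun k => Nat.card F ^ k) (fun _ _ => Nat.zero_le _)
    (Finset.mem_range.2 (Nat.sub_one_lt Module.finrank_pos.ne'))

theorem exists_pow_le_ncard_le_finrank_ker_sub_mulLeft_of_isScalarTower {E : Type*} [Field E]
    [Algebra F E] [Algebra L E] [IsScalarTower F L E] [Finite E] :
    ∃ w : E →ₗ[F] E, Nat.card F ^ (finrank F L - 1) ≤
      {a : E | finrank L E ≤ finrank F (LinearMap.ker (w - LinearMap.mulLeft F a))}.ncard := by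
  have : Finite F := Finite.of_injective _ (algebraMap F E).injective
  have : Finite L := Finite.of_injective _ (algebraMap L E).injective
  have := Fintype.ofFinite F
  let φ : L →ₗ[F] L := (FiniteField.frobeniusAlgHom F L).toLinearMap
  have hφ (u : Lˣ) : φ u / u = ((u ^ (Nat.card F - 1) : Lˣ) : L) := by
    rw [div_eq_iff u.ne_zero, ← Units.val_mul, ← pow_succ,
      Nat.sub_add_cancel Nat.card_pos, Nat.card_eq_fintype_card]
    rfl
  let emb : Lˣ → E := fun u => algebraMap L E u
  have hemb : Function.Injective emb := (algebraMap L E).injective.comp Units.val_injective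
  let w := coordwise (Module.finBasis L E) φ
  refine ⟨w, ?_⟩
  calc Nat.card F ^ (finrank F L - 1)
      ≤ Nat.card (powMonoidHom (Nat.card F - 1) : Lˣ →* Lˣ).range :=
        pow_finrank_sub_one_le_card_range_powMonoidHom
    _ = (emb '' (powMonoidHom (Nat.card F - 1) : Lˣ →* Lˣ).range).ncard :=
        (Set.ncard_image_of_injective _ hemb).symm
    _ ≤ _ := by
        refine Set.ncard_le_ncard ?_ (Set.toFinite _)
        rintro _ ⟨_, ⟨u, rfl⟩, rfl⟩
        have hmul : Algebra.lsmul F F E (φ u / u) =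
            LinearMap.mulLeft F (emb (powMonoidHom (Nat.card F - 1) u)) := by
          ext y
          rw [hφ]
          exact Algebra.smul_def _ y
        change finrank L E ≤ finrank F (LinearMap.ker (w - LinearMap.mulLeft F _))
        rw [← hmul]
        exact finrank_le_finrank_ker_coordwise_sub_lsmul _ φ u.ne_zero

theorem exists_intermediateField_finrank_eq {E : Type*} [Field E] [Algebra F E] [Finite E] {r : ℕ}
    (hr : r ∣ finrank F E) : ∃ L : IntermediateField F E, finrank F L = r := by
  have : Finite F := Finite.of_injective _ (algebraMap F E).injective
  have : NeZero r := ⟨ne_zero_of_dvd_ne_zero Module.finrank_pos.ne' hr⟩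
  obtain ⟨p, _⟩ := CharP.exists F
  have : Fact p.Prime := ⟨CharP.char_is_prime F p⟩
  have hL : finrank F (FiniteField.Extension F p r) = r := FiniteField.finrank_extension F p r
  obtain ⟨f⟩ := FiniteField.nonempty_algHom_of_finrank_dvd (hL.symm ▸ hr)
  exact ⟨f.fieldRange, f.equivFieldRange.toLinearEquiv.finrank_eq.symm.trans hL⟩

theorem exists_pow_le_ncard_le_finrank_ker_sub_mulLeft {E : Type*} [Field E] [Algebra F E]
    [Finite E] {s r : ℕ} (hE : finrank F E = s * r) :
    ∃ w : E →ₗ[F] E, Nat.card F ^ (r - 1) ≤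
      {a : E | s ≤ finrank F (LinearMap.ker (w - LinearMap.mulLeft F a))}.ncard := by
  obtain ⟨L, hL⟩ := exists_intermediateField_finrank_eq (hE ▸ Nat.dvd_mul_left r s)
  have hs : finrank L E = s := by
    have hpos : 0 < finrank F L := Module.finrank_pos
    have htower := Module.finrank_mul_finrank F L E
    rw [hE, hL, mul_comm] at htower
    exact Nat.eq_of_mul_eq_mul_right (hL ▸ hpos) htower
  rw [← hs, ← hL]
  exact exists_pow_le_ncard_le_finrank_ker_sub_mulLeft_of_isScalarTower

end Multipliers

section Codewords

variable {F K : Type*} [Field F] [Field K] [Algebra F K] {n : ℕ}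

theorem rankDist_comp_add_finrank_ker_sub_le {V W : Type*} [AddCommGroup V] [Module F V]
    [FiniteDimensional F V] [AddCommGroup W] [Module F W] (g : W →ₗ[F] K) (f₁ f₂ : V →ₗ[F] W)
    (x : Fin n → V) :
    rankDist F (g ∘ f₁ ∘ x) (g ∘ f₂ ∘ x) + finrank F (LinearMap.ker (f₁ - f₂)) ≤ finrank F V := by
  have hspan : Submodule.span F (Set.range (g ∘ f₁ ∘ x - g ∘ f₂ ∘ x)) ≤
      LinearMap.range (g ∘ₗ (f₁ - f₂)) := by
    refine Submodule.span_le.2 (Set.range_subset_iff.2 fun l => ⟨x l, ?_⟩)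
    exact map_sub g (f₁ (x l)) (f₂ (x l))
  calc rankDist F (g ∘ f₁ ∘ x) (g ∘ f₂ ∘ x) + finrank F (LinearMap.ker (f₁ - f₂))
      ≤ finrank F (LinearMap.range (g ∘ₗ (f₁ - f₂))) +
          finrank F (LinearMap.ker (g ∘ₗ (f₁ - f₂))) :=
        add_le_add (Submodule.finrank_mono hspan)
          (Submodule.finrank_mono (LinearMap.ker_le_ker_comp _ _))
    _ = finrank F V := LinearMap.finrank_range_add_finrank_ker _

theorem IsBasisOfMul.exists_mem_eq_mul {β : K} {E : IntermediateField F K} {α : Fin n → K}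
    (hα : IsBasisOfMul β E α) (l : Fin n) : ∃ x ∈ E, α l = β * x := by
  have hl : α l ∈ (Submodule.span F (Set.range α) : Set K) :=
    Submodule.subset_span (Set.mem_range_self l)
  rwa [hα.2] at hl

theorem IsBasisOfMul.ne_zero {β : K} {E : IntermediateField F K} {α : Fin n → K}
    (hα : IsBasisOfMul β E α) (hβ : β ≠ 0) : α ≠ 0 := by
  rintro rfl
  have hmem : β ∈ (Submodule.span F (Set.range (0 : Fin n → K)) : Set K) :=
    hα.2 ▸ ⟨1, E.one_mem, (mul_one β).symm⟩
  have hbot : Submodule.span F (Set.range (0 : Fin n → K)) ≤ ⊥ :=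
    Submodule.span_le.2 (Set.range_subset_iff.2 fun _ => rfl)
  exact hβ (hbot hmem)

theorem comp_mulLeft_mem_sigmaPower_gabidulin (σ : K ≃ₐ[F] K) {E : IntermediateField F K} (j : ℕ)
    {k : ℕ} (hk : 0 < k) {a : K} (ha : a ∈ E) :
    (σ ^ j).toLinearMap ∘ₗ LinearMap.mulLeft F a ∈ sigmaPower σ j (gabidulin σ E k) := by
  have : NeZero k := ⟨hk.ne'⟩
  refine ⟨_, ⟨Pi.single 0 a, fun i => ?_, ?_⟩, rfl⟩
  · obtain rfl | hi := eq_or_ne i 0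
    · rwa [Pi.single_eq_same]
    · rw [Pi.single_eq_of_ne hi]
      exact E.zero_mem
  · ext x
    simp [sigmaPoly, Pi.single_apply]

theorem exists_pow_le_encard_evalCode_inter_ball {s r τ : ℕ} {E : IntermediateField F K} [Finite E]
    (hE : finrank F E = s * r) {θ : K →ₗ[F] K} (hθ : Function.Injective θ) {β : K} {α : Fin n → K}
    (hα : ∀ l, ∃ x ∈ E, α l = β * x) (hα₀ : α ≠ 0) {𝒞 : Set (K →ₗ[F] K)}
    (h𝒞 : ∀ a ∈ E, θ ∘ₗ LinearMap.mulLeft F a ∈ 𝒞) (hτ : s * r ≤ τ + s) :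
    ∃ w : Fin n → K, ((Nat.card F ^ (r - 1) : ℕ) : ℕ∞) ≤ (evalCode 𝒞 α ∩ ball F τ w).encard := by
  choose x hxE hx using hα
  obtain ⟨w, hw⟩ := exists_pow_le_ncard_le_finrank_ker_sub_mulLeft hE
  let y : Fin n → E := fun l => ⟨x l, hxE l⟩
  let g : E →ₗ[F] K := θ ∘ₗ LinearMap.mulLeft F β ∘ₗ E.val.toLinearMap
  let codeword : E → Fin n → K := fun a l => θ (a * α l)
  have hinj : Function.Injective codeword := by
    obtain ⟨l, hl⟩ := Function.ne_iff.1 hα₀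
    exact fun a b hab => Subtype.ext (mul_right_cancel₀ hl (hθ (congrFun hab l)))
  have hcodeword (a : E) : codeword a = g ∘ LinearMap.mulLeft F a ∘ y := by
    ext l
    change θ (a * α l) = θ (β * (a * x l))
    rw [hx, mul_left_comm]
  have hdist {a : E} (ha : s ≤ finrank F (LinearMap.ker (w - LinearMap.mulLeft F a))) :
      rankDist F (g ∘ w ∘ y) (codeword a) ≤ τ := by
    have hrank := rankDist_comp_add_finrank_ker_sub_le g w (LinearMap.mulLeft F a) y
    rw [hcodeword]
    omega
  refine ⟨g ∘ w ∘ y, ?_⟩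
  calc ((Nat.card F ^ (r - 1) : ℕ) : ℕ∞)
      ≤ {a : E | s ≤ finrank F (LinearMap.ker (w - LinearMap.mulLeft F a))}.encard := by
        rw [← (Set.toFinite _).cast_ncard_eq]
        exact_mod_cast hw
    _ = (codeword '' _).encard := (hinj.encard_image _).symm
    _ ≤ _ := by
        refine Set.encard_le_encard ?_
        rintro _ ⟨a, ha, rfl⟩
        exact ⟨⟨_, h𝒞 a a.2, rfl⟩, hdist ha⟩

end Codewords

section RunningTime

theorem Machine.length_output_run_le (M : Machine) (input : List Symb) (T : ℕ) :
    (M.run input T).output.length ≤ T := by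
  induction T with
  | zero => exact Nat.le_refl 0
  | succ T ih =>
    have hrun : M.run input (T + 1) = (M.step (M.run input T)).getD (M.run input T) :=
      Function.iterate_succ_apply' _ _ _
    rw [hrun, Machine.step]
    cases M.trans (M.run input T).state fun k => ((M.run input T).tapes k).head with
    | none => exact ih.trans T.le_succ
    | some a =>
      have hlen : a.2.2.toList.length ≤ 1 := by
        cases a.2.2 <;> simp
      simpa using add_le_add ih hlen

theorem length_le_length_encodeList {K : Type*} (enc : K → List Bool) {n : ℕ}
    (L : List (Fin n → K)) : L.length ≤ (encodeList enc L).length := by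
  rw [encodeList, List.length_flatMap]
  calc L.length = (L.map fun c => (encodeWord enc c ++ [Symb.semicolon]).length).length :=
        List.length_map _ |>.symm
    _ ≤ _ := List.length_le_sum_of_one_le _ (by simp)

theorem EfficientlyListDecodable.exists_encard_inter_ball_le {ι : Type*} {F K : ι → Type*}
    [∀ i, Field (F i)] [∀ i, Field (K i)] [∀ i, Algebra (F i) (K i)] {n : ι → ℕ}
    {C : ∀ i, Set (Fin (n i) → K i)} {τ : ι → ℕ} (h : EfficientlyListDecodable F C τ) :
    ∃ p : Polynomial ℕ, ∀ i w, (C i ∩ ball (F i) (τ i) w).encard ≤ (p.eval (n i) : ℕ) := by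
  classical
  obtain ⟨M, desc, enc, p, -, h⟩ := h
  refine ⟨p, fun i w => ?_⟩
  obtain ⟨L, hL, -, hout⟩ := h i w
  have hset : C i ∩ ball (F i) (τ i) w = L.toFinset := by
    ext c
    rw [Finset.mem_coe, List.mem_toFinset, hL]
  rw [hset, Set.encard_coe_eq_coe_finsetCard, Nat.cast_le]
  calc L.toFinset.card ≤ L.length := L.toFinset_card_le
    _ ≤ (encodeList (enc i) L).length := length_le_length_encodeList _ _
    _ ≤ p.eval (n i) := hout ▸ M.length_output_run_le _ _

end RunningTime

section Growth

open Filter Asymptotics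

theorem eventually_eval_lt_pow (p : Polynomial ℕ) {b : ℕ} (hb : 1 < b) :
    ∀ᶠ t : ℕ in atTop, p.eval t < b ^ t := by
  have hlittle : (fun t : ℕ => ((p.eval t : ℕ) : ℝ)) =o[atTop] fun t : ℕ => (b : ℝ) ^ t := by
    simp only [Polynomial.eval_eq_sum_range, Nat.cast_sum, Nat.cast_mul, Nat.cast_pow]
    exact IsLittleO.fun_sum fun k _ =>
      (isLittleO_pow_const_const_pow_of_one_lt k (Nat.one_lt_cast.2 hb)).const_mul_left _
  filter_upwards [hlittle.bound (show (0 : ℝ) < 1 / 2 by norm_num)] with t ht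
  have hpos : (0 : ℝ) < (b : ℝ) ^ t := by positivity
  rw [Real.norm_natCast, Real.norm_of_nonneg hpos.le] at ht
  exact_mod_cast ht.trans_lt (by linarith : 1 / 2 * (b : ℝ) ^ t < (b : ℝ) ^ t)

theorem exists_eval_lt_pow_sub {ι : Type*} {q n t : ι → ℕ} {k : ℕ} (hq : ∀ i, 1 < q i)
    (hnt : ∀ i, n i ≤ t i ^ k) (hn : ∀ N, ∃ i, N ≤ n i) (c : ℕ) (p : Polynomial ℕ) :
    ∃ i, p.eval (n i) < q i ^ (t i - c) := by
  obtain ⟨N, hN⟩ := eventually_atTop.1 <|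
    eventually_eval_lt_pow (Polynomial.C (2 ^ c) * p.comp (Polynomial.X ^ k)) one_lt_two
  obtain ⟨i, hi⟩ := hn (N ^ k + 1)
  have hNt : N < t i := lt_of_pow_lt_pow_left₀ k (Nat.zero_le _) (hi.trans (hnt i))
  have hp : 2 ^ c * p.eval (t i ^ k) < 2 ^ t i := by
    simpa [Polynomial.eval_comp] using hN (t i) hNt.le
  have hmono : p.eval (n i) ≤ p.eval (t i ^ k) := by
    simp only [Polynomial.eval_eq_sum_range]
    gcongr
    apply hnt
  refine ⟨i, lt_of_mul_lt_mul_left (a := 2 ^ c) ?_ (Nat.zero_le _)⟩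
  calc 2 ^ c * p.eval (n i) ≤ 2 ^ c * p.eval (t i ^ k) := Nat.mul_le_mul_left _ hmono
    _ < 2 ^ t i := hp
    _ ≤ 2 ^ (c + (t i - c)) := Nat.pow_le_pow_right two_pos (by omega)
    _ = 2 ^ c * 2 ^ (t i - c) := pow_add _ _ _
    _ ≤ 2 ^ c * q i ^ (t i - c) := Nat.mul_le_mul_left _ (Nat.pow_le_pow_left (hq i) _)

end Growth

end RankMetric

theorem mainTheorem9_general {ι : Type*} (F K : ι → Type*)
    [∀ i, Field (F i)] [∀ i, Field (K i)] [∀ i, Algebra (F i) (K i)]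
    (n s r k j : ι → ℕ)
    (E : ∀ i, IntermediateField (F i) (K i)) [∀ i, Finite (E i)]
    (σ : ∀ i, K i ≃ₐ[F i] K i)
    (β : ∀ i, K i)
    (α : ∀ i, Fin (n i) → K i)
    (𝒞 : ∀ i, Set (K i →ₗ[F i] K i))
    (hE : ∀ i, Module.finrank (F i) (E i) = s i * r i)
    (hα : ∀ i l, ∃ x ∈ E i, α i l = β i * x)
    (hα₀ : ∀ i, α i ≠ 0)
    (hk : ∀ i, 0 < k i)
    (h𝒞 : ∀ i, RankMetric.sigmaPower (σ i) (j i) (RankMetric.gabidulin (σ i) (E i) (k i)) ⊆ 𝒞 i)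
    (h_growth : ∀ p : Polynomial ℕ, ∃ i, p.eval (n i) < Nat.card (F i) ^ (r i - 1))
    (τ : ι → ℕ) (hτ : ∀ i, s i * r i ≤ τ i + s i) :
    ¬ RankMetric.EfficientlyListDecodable F
        (fun i => RankMetric.evalCode (𝒞 i) (α i)) τ := by
  intro hdec
  obtain ⟨p, hp⟩ := hdec.exists_encard_inter_ball_le
  obtain ⟨i, hi⟩ := h_growth p
  obtain ⟨w, hw⟩ := RankMetric.exists_pow_le_encard_evalCode_inter_ball (hE i)
    (σ i ^ j i).injective (hα i) (hα₀ i)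
    (fun _ ha => h𝒞 i (RankMetric.comp_mulLeft_mem_sigmaPower_gabidulin (σ i) (j i) (hk i) ha))
    (hτ i)
  exact hi.not_ge (Nat.cast_le.1 (hw.trans (hp i w)))

/-- For each index `i`: `F i` is `𝔽_q`, `K i` is `𝔽_{q^m}` and `E i` is its subfield `𝔽_{q^n}`
(so that `n ∣ m`), and `σ i` generates the Galois group of `K i` over `F i`. -/
theorem mainTheorem9 {ι : Type*} (F K : ι → Type*)
    [∀ i, Field (F i)] [∀ i, Field (K i)] [∀ i, Finite (K i)] [∀ i, Algebra (F i) (K i)]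
    (n m t d j : ι → ℕ)
    (E : ∀ i, IntermediateField (F i) (K i))
    (σ : ∀ i, K i ≃ₐ[F i] K i)
    (β : ∀ i, K i)
    (α : ∀ i, Fin (n i) → K i)
    (𝒞 : ∀ i, Set (K i →ₗ[F i] K i))
    (hq : ∀ i, ∃ e : ℕ, Nat.card (F i) = 2 ^ e)
    (hm : ∀ i, Module.finrank (F i) (K i) = m i)
    (hnm : ∀ i, n i ∣ m i)
    (hE : ∀ i, Module.finrank (F i) (E i) = n i)
    (hσ : ∀ i, ∀ g : K i ≃ₐ[F i] K i, g ∈ Subgroup.zpowers (σ i))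
    (hβ : ∀ i, β i ≠ 0)
    (hα : ∀ i, RankMetric.IsBasisOfMul (β i) (E i) (α i))
    (hd : ∀ i, RankMetric.IsMinDist (F i) (RankMetric.evalCode (𝒞 i) (α i)) (d i))
    (ht : ∀ i, ∃ e : ℕ, t i = 2 ^ e)
    (hn : ∀ i, n i = t i ^ 2 - 1)
    (ht_lower : ∀ i, (n i : ℤ) - d i + 1 ≤ t i)
    (ht_upper : ∀ i, (t i : ℤ) ≤ n i - ((d i : ℤ) - 1) / 2 - 1)
    (hj : ∀ i, (j i : ℤ) < n i - t i)
    (h𝒞 : ∀ i, RankMetric.sigmaPower (σ i) (j i) (RankMetric.gabidulin (σ i) (E i) 2) ⊆ 𝒞 i)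
    (h_unbounded : ∀ N : ℕ, ∃ i, N ≤ n i)
    (τ : ι → ℕ) (hτ : ∀ i, (n i : ℤ) - t i ≤ τ i) :
    ¬ RankMetric.EfficientlyListDecodable F
        (fun i => RankMetric.evalCode (𝒞 i) (α i)) τ := by
  have hcard (i : ι) : 1 < Nat.card (F i) := by
    have : Finite (F i) := Finite.of_injective _ (algebraMap (F i) (K i)).injective
    exact Finite.one_lt_card
  have hfactor (i : ι) : n i = (t i + 1) * (t i - 1) := (hn i).trans (Nat.sq_sub_sq (t i) 1)
  have hradius (i : ι) : (t i + 1) * (t i - 1) ≤ τ i + (t i + 1) := by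
    rw [← hfactor]
    have := hτ i
    omega
  exact mainTheorem9_general F K n (t · + 1) (t · - 1) (fun _ => 2) j E σ β α 𝒞
    (fun i => (hE i).trans (hfactor i)) (fun i => (hα i).exists_mem_eq_mul)
    (fun i => (hα i).ne_zero (hβ i)) (fun _ => two_pos) h𝒞
    (RankMetric.exists_eval_lt_pow_sub hcard (fun i => (hn i).trans_le (Nat.sub_le _ 1))
      h_unbounded 2)
    τ hradius
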